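/- All rings are commutative with unity. Let $A\subset B$ be an extension of reduced rings. For an intermediate ring $A\subset C\subset B$, call $C$ elementary subintegral over $A$ if $C=A[b]$ for some $b\in C$ with $b^2,b^3\in A$, and subintegral over $A$ if $C$ is a union of subrings each obtained from $A$ by a finite succession of elementary subintegral extensions. Assume that $A$ is subintegrally closed in $B$, i.e. that the largest subintegral extension of $A$ in $B$ is $A$ itself. For a ring extension $R\subset S$ let $\mathcal I(R,S)$ denote the multiplicative group of invertible $R$-submodules of $S$, i.e. of those $R$-submodules $I$ of $S$ for which there is an $R$-submodule $J$ of $S$ with $IJ=R$. Then for all integers $m,n\ge 0$ the homomorphism $$\mathcal I(A,B)\longrightarrow \mathcal I\big(A[X_1,\ldots,X_m],\,B[X_1,\ldots,X_m,Y_1,\ldots,Y_n]\big),\qquad I\longmapsto I\cdot A[X_1,\ldots,X_m],$$ induced by the inclusion $B\subset B[X_1,\ldots,X_m,Y_1,\ldots,Y_n]$ is an isomorphism of groups; in particular $$\mathcal I(A,B)\cong \mathcal I\big(A[X_1,\ldots,X_m],\,B[X_1,\ldots,X_m,Y_1,\ldots,Y_n]\big).$$ -/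

import Mathlib

namespace RingExt

section Subintegral

variable {B : Type*} [CommRing B]

/-- `A ⊆ C` (subrings of `B`) is elementary subintegral: `C = A[b]` with `b ^ 2, b ^ 3 ∈ A`. -/
def IsElementarySubintegral (A C : Subring B) : Prop :=
  ∃ b : B, b ^ 2 ∈ A ∧ b ^ 3 ∈ A ∧ C = (Algebra.adjoin A {b}).toSubring

/-- `C` is obtained from `A` by a finite succession of elementary subintegral extensions. -/
def IsFiniteSubintegral (A C : Subring B) : Prop :=
  Relation.ReflTransGen IsElementarySubintegral A C

/-- `A ⊆ C` (subrings of `B`) is subintegral: `C` is a union of subrings, each obtained from `A`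
by a finite succession of elementary subintegral extensions. -/
def IsSubintegral (A C : Subring B) : Prop :=
  ∃ S : Set (Subring B), (∀ D ∈ S, IsFiniteSubintegral A D) ∧ (C : Set B) = ⋃ D ∈ S, (D : Set B)

/-- The subintegral closure of `A` in `B`. It is the largest subintegral extension of `A` in `B`
by `isGreatest_subintegralClosure` below. -/
def subintegralClosure (A : Subring B) : Subring B :=
  sSup {C | IsSubintegral A C}

/-- `A` is subintegrally closed in `B`: it is equal to its subintegral closure in `B`. -/
def IsSubintegrallyClosed (A : Subring B) : Prop :=
  subintegralClosure A = A

theorem adjoin_toSubring_eq (A : Subring B) (b : B) :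
    (Algebra.adjoin A {b}).toSubring = A ⊔ Subring.closure {b} := by
  apply le_antisymm
  · intro x hx
    replace hx : x ∈ Algebra.adjoin A {b} := hx
    induction hx using Algebra.adjoin_induction with
    | mem x hx => exact (le_sup_right : _ ≤ A ⊔ _) (Subring.subset_closure hx)
    | algebraMap r => exact (le_sup_left : A ≤ A ⊔ _) r.2
    | add x y hx hy h1 h2 => exact add_mem h1 h2
    | mul x y hx hy h1 h2 => exact mul_mem h1 h2
  · refine sup_le ?_ ?_
    · intro x hx
      exact (Algebra.adjoin A {b}).algebraMap_mem ⟨x, hx⟩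
    · rw [Subring.closure_le]
      exact Algebra.subset_adjoin

theorem IsFiniteSubintegral.sup {A D E : Subring B} (hD : IsFiniteSubintegral A D)
    (hE : IsFiniteSubintegral A E) : IsFiniteSubintegral A (D ⊔ E) := by
  induction hE with
  | refl =>
    have h : A ≤ D := by
      induction hD with
      | refl => exact le_rfl
      | tail _ h ih =>
        obtain ⟨b, -, -, rfl⟩ := h
        rw [adjoin_toSubring_eq]
        exact ih.trans le_sup_left
    rwa [sup_eq_left.2 h]
  | @tail E F _ h ih =>
    obtain ⟨b, h2, h3, rfl⟩ := h
    refine Relation.ReflTransGen.tail ih ⟨b, (le_sup_right : E ≤ D ⊔ E) h2,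
      (le_sup_right : E ≤ D ⊔ E) h3, ?_⟩
    rw [adjoin_toSubring_eq, adjoin_toSubring_eq, sup_assoc]

theorem isGreatest_subintegralClosure (A : Subring B) :
    IsGreatest {C | IsSubintegral A C} (subintegralClosure A) := by
  refine ⟨⟨{D | IsFiniteSubintegral A D}, fun D h => h, ?_⟩, fun C hC => le_sSup hC⟩
  have hdir : DirectedOn (· ≤ ·) {D : Subring B | IsFiniteSubintegral A D} :=
    fun D hD E hE => ⟨D ⊔ E, IsFiniteSubintegral.sup hD hE, le_sup_left, le_sup_right⟩
  have hsup : subintegralClosure A = sSup {D : Subring B | IsFiniteSubintegral A D} := by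
    apply le_antisymm
    · refine sSup_le ?_
      rintro C ⟨S, hS, hC⟩ x hx
      have hx' : x ∈ (C : Set B) := hx
      rw [hC] at hx'
      simp only [Set.mem_iUnion] at hx'
      obtain ⟨D, hD, hxD⟩ := hx'
      exact (le_sSup (hS D hD) : D ≤ _) hxD
    · refine sSup_le fun D hD => le_sSup ⟨{D}, ?_, by simp⟩
      rintro _ rfl
      exact hD
  rw [hsup]
  exact Subring.coe_sSup_of_directedOn ⟨A, Relation.ReflTransGen.refl⟩ hdir

end Subintegral

/-- The group `𝓘(A, B)` of invertible `A`-submodules of `B`: the submodules `I` such that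
`I * J = A` for some `A`-submodule `J` of `B`. The group law is multiplication of submodules. -/
abbrev InvSubmodules {B : Type*} [CommRing B] (A : Subring B) : Type _ :=
  (Submodule A B)ˣ

section Functor

variable {B B' : Type*} [CommRing B] [CommRing B']

/-- The `A'`-submodule of `B'` generated by the image of an `A`-submodule of `B`, where
`φ : B → B'` is a ring homomorphism with `φ(A) ⊆ A'`, as a multiplicative map. -/
def extendSubmodule {A : Subring B} {A' : Subring B'} (φ : B →+* B')
    (h : ∀ a ∈ A, φ a ∈ A') : Submodule A B →* Submodule A' B' where
  toFun I := Submodule.span A' (φ '' I)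
  map_one' := by
    apply le_antisymm
    · rw [Submodule.span_le]
      rintro _ ⟨x, hx, rfl⟩
      obtain ⟨a, rfl⟩ := Submodule.mem_one.1 hx
      exact Submodule.mem_one.2 ⟨⟨φ a, h a a.2⟩, rfl⟩
    · rw [Submodule.one_le]
      exact Submodule.subset_span ⟨1, Submodule.one_le.1 le_rfl, map_one φ⟩
  map_mul' I J := by
    apply le_antisymm
    · rw [Submodule.span_le]
      rintro _ ⟨x, hx, rfl⟩
      refine Submodule.mul_induction_on (C := fun x => φ x ∈
        Submodule.span A' (φ '' I) * Submodule.span A' (φ '' J)) hx ?_ ?_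
      · intro m hm n hn
        rw [map_mul]
        exact Submodule.mul_mem_mul (Submodule.subset_span ⟨m, hm, rfl⟩)
          (Submodule.subset_span ⟨n, hn, rfl⟩)
      · intro x y hx hy
        rw [map_add]
        exact add_mem hx hy
    · rw [Submodule.span_mul_span]
      refine Submodule.span_mono ?_
      rintro _ ⟨_, ⟨x, hx, rfl⟩, _, ⟨y, hy, rfl⟩, rfl⟩
      exact ⟨x * y, Submodule.mul_mem_mul hx hy, map_mul φ x y⟩

/-- The group homomorphism `𝓘(φ) : 𝓘(A, B) → 𝓘(A', B')` induced by a morphism `φ` of ring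
extensions, sending `I` to the `A'`-submodule of `B'` generated by `φ(I)`. -/
def InvSubmodules.map {A : Subring B} {A' : Subring B'} (φ : B →+* B')
    (h : ∀ a ∈ A, φ a ∈ A') : InvSubmodules A →* InvSubmodules A' :=
  Units.map (extendSubmodule φ h)

end Functor

section Polynomial

variable {B : Type*} [CommRing B]

/-- The polynomial ring `A[X₁, …, Xₘ]` as a subring of `B[X₁, …, Xₘ, Y₁, …, Yₙ]`. The variables
indexed by `Fin m` are the `Xᵢ`, those indexed by `Fin n` are the `Yⱼ`. -/
noncomputable def polySubring (A : Subring B) (m n : ℕ) : Subring (MvPolynomial (Fin m ⊕ Fin n) B) :=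
  ((MvPolynomial.rename (R := B) (Sum.inl : Fin m → Fin m ⊕ Fin n)).toRingHom.comp
    (MvPolynomial.map A.subtype)).range

theorem C_mem_polySubring (A : Subring B) (m n : ℕ) (a : B) (ha : a ∈ A) :
    (MvPolynomial.C a : MvPolynomial (Fin m ⊕ Fin n) B) ∈ polySubring A m n :=
  ⟨MvPolynomial.C ⟨a, ha⟩, by simp⟩

end Polynomial

end RingExt

/-!
An invertible `I`, with inverse `J`, over `A[X] ⊆ B[X, Y]` contains `f₁, …, fₖ` such that
`∑ fᵢ gᵢ = 1` for suitable `gⱼ ∈ J`, and all products `fᵢ gⱼ` lie in `A[X]`. Setting all variables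
to `0` gives a retraction of the extension map, so it suffices to show `I = A[X]` when the constant
coefficients of `I` and `J` lie in `A`; as the `fᵢ` generate `I`, it is enough that `fᵢ ∈ A[X]`, and
likewise for `J`.

By Kronecker's theorem the products of a coefficient of `fᵢ` and one of `gⱼ` are integral over `A`,
hence so are the coefficients themselves, and `B` may be replaced by the finite `A`-algebra which
they generate. The conductor `c` of `A` in this algebra is a radical ideal because `A` is seminormal
in it. If `c` were proper, localize `A/c ⊆ B/c` at a minimal prime of `A/c`: over the resulting
field `k` every invertible `k[X]`-module is principal and the units of `K[X]`, with `K` reduced, are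
constant, so the localized coefficients lie in `k`. Then some nonzero element of `A/c` multiplies
`B/c` into `A/c`, which contradicts the definition of the conductor.

The variables `Y` do not occur in `fᵢ` since degrees are additive modulo every prime of the reduced
ring `B`.
-/

namespace RingExt

open MvPolynomial

section DedekindMertens

section Semiring

variable {L : Type*} [IdemCommSemiring L]

theorem add_pow_succ_le (a b : L) (n : ℕ) :
    (a + b) ^ (n + 1) ≤ a ^ (n + 1) + b * (a + b) ^ n := by
  induction n with
  | zero => simp
  | succ n ih =>
    calc (a + b) ^ (n + 1 + 1) = a * (a + b) ^ (n + 1) + b * (a + b) ^ (n + 1) := by ring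
      _ ≤ a * (a ^ (n + 1) + b * (a + b) ^ n) + b * (a + b) ^ (n + 1) := by gcongr
      _ = a ^ (n + 1 + 1) + (b * (a * (a + b) ^ n) + b * (a + b) ^ (n + 1)) := by ring
      _ ≤ a ^ (n + 1 + 1) + (b * ((a + b) * (a + b) ^ n) + b * (a + b) ^ (n + 1)) := by
        gcongr
        exact le_self_add
      _ = a ^ (n + 1 + 1) + b * (a + b) ^ (n + 1) := by rw [← pow_succ', add_idem]

-- Read `F, G, H` as the coefficient spans of `f, g, f * g`, read `a, b` as the spans of the leading
-- coefficients, `F', G'` as the coefficient spans of `f, g` without their leading terms `f', g'`,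
-- and `H', H''` as those of `f * g', f' * g`.
theorem dedekindMertens_step {F G H F' G' H' H'' a b : L} (k : ℕ)
    (hF : F = F' + a) (hG : G = G' + b) (hab : a * b ≤ H)
    (hH' : H' ≤ H + b * F) (hH'' : H'' ≤ H + a * G)
    (hFG' : F ^ (k + 1) * G' ≤ F ^ k * H') (hF'G : F' ^ (k + 2) * G ≤ F' ^ (k + 1) * H'') :
    F ^ (k + 2) * G ≤ F ^ (k + 1) * H := by
  have hF' : F' ≤ F := hF ▸ le_self_add
  have ha : a ≤ F := hF ▸ le_add_self
  have hb : b ≤ G := hG ▸ le_add_self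
  have hFG : F ^ (k + 1) * G ≤ F ^ k * H + b * F ^ (k + 1) := by
    calc F ^ (k + 1) * G = F ^ (k + 1) * G' + b * F ^ (k + 1) := by rw [hG]; ring
      _ ≤ F ^ k * H' + b * F ^ (k + 1) := by gcongr
      _ ≤ F ^ k * (H + b * F) + b * F ^ (k + 1) := by gcongr
      _ = F ^ k * H + (b * F ^ (k + 1) + b * F ^ (k + 1)) := by ring
      _ = F ^ k * H + b * F ^ (k + 1) := by rw [add_idem]
  have haFG : a * (F ^ (k + 1) * G) ≤ F ^ (k + 1) * H := by
    calc a * (F ^ (k + 1) * G) ≤ a * (F ^ k * H + b * F ^ (k + 1)) := by gcongr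
      _ = a * (F ^ k * H) + a * b * F ^ (k + 1) := by ring
      _ ≤ F * (F ^ k * H) + H * F ^ (k + 1) := by gcongr
      _ = F ^ (k + 1) * H + F ^ (k + 1) * H := by ring
      _ = F ^ (k + 1) * H := add_idem _
  have hbF : b * F ^ (k + 2) ≤ F ^ (k + 1) * H := by
    calc b * F ^ (k + 2) ≤ b * (F' ^ (k + 2) + a * F ^ (k + 1)) := by
          gcongr
          exact hF ▸ add_pow_succ_le F' a (k + 1)
      _ = b * F' ^ (k + 2) + a * b * F ^ (k + 1) := by ring
      _ ≤ G * F' ^ (k + 2) + H * F ^ (k + 1) := by gcongr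
      _ = F' ^ (k + 2) * G + F ^ (k + 1) * H := by ring
      _ ≤ F' ^ (k + 1) * H'' + F ^ (k + 1) * H := by gcongr
      _ ≤ F ^ (k + 1) * (H + a * G) + F ^ (k + 1) * H := by gcongr
      _ = a * (F ^ (k + 1) * G) + (F ^ (k + 1) * H + F ^ (k + 1) * H) := by ring
      _ ≤ F ^ (k + 1) * H := by rw [add_idem]; exact add_le haFG le_rfl
  calc F ^ (k + 2) * G = F * (F ^ (k + 1) * G) := by ring
    _ ≤ F * (F ^ k * H + b * F ^ (k + 1)) := by gcongr
    _ = F ^ (k + 1) * H + b * F ^ (k + 2) := by ring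
    _ ≤ F ^ (k + 1) * H := add_le le_rfl hbF

end Semiring

section EraseTerm

variable {σ R : Type*} [CommRing R] (d : σ →₀ ℕ) (f : MvPolynomial σ R)

/-- The polynomial obtained from `f` by removing its term of multidegree `d`. -/
noncomputable def eraseTerm : MvPolynomial σ R :=
  f - monomial d (f.coeff d)

theorem coeff_eraseTerm_self : (eraseTerm d f).coeff d = 0 := by
  classical simp [eraseTerm]

variable {d} in
theorem coeff_eraseTerm_of_ne {e : σ →₀ ℕ} (h : e ≠ d) : (eraseTerm d f).coeff e = f.coeff e := by
  classical simp [eraseTerm, coeff_monomial, h.symm]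

variable {d f} in
theorem card_support_eraseTerm_lt (h : d ∈ f.support) :
    (eraseTerm d f).support.card < f.support.card := by
  refine Finset.card_lt_card (Finset.ssubset_iff_of_subset (fun e he => ?_) |>.2
    ⟨d, h, by simp [coeff_eraseTerm_self]⟩)
  obtain rfl | hed := eq_or_ne e d
  · exact h
  · rwa [mem_support_iff, coeff_eraseTerm_of_ne f hed, ← mem_support_iff] at he

end EraseTerm

variable {σ : Type*} (A : Type*) {B : Type*} [CommRing A] [CommRing B] [Algebra A B]

/-- The `A`-submodule of `B` spanned by the coefficients of a polynomial over `B`, called the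
content of the polynomial in the literature on the Dedekind–Mertens lemma. -/
noncomputable def coeffSpan (f : MvPolynomial σ B) : Submodule A B :=
  Submodule.span A (f.coeffs : Set B)

variable {A} in
theorem coeffSpan_le_iff {f : MvPolynomial σ B} {M : Submodule A B} :
    coeffSpan A f ≤ M ↔ f ∈ coeffsIn σ M :=
  Submodule.span_le.trans mem_coeffsIn_iff_coeffs_subset.symm

theorem coeff_mem_coeffSpan (f : MvPolynomial σ B) (d : σ →₀ ℕ) : f.coeff d ∈ coeffSpan A f :=
  mem_coeffsIn.1 (coeffSpan_le_iff.1 le_rfl) d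

theorem coeffSpan_fg (f : MvPolynomial σ B) : (coeffSpan A f).FG :=
  ⟨f.coeffs, rfl⟩

theorem coeffSpan_zero : coeffSpan A (0 : MvPolynomial σ B) = 0 := by
  simp [coeffSpan]

theorem coeffSpan_eq_add (d : σ →₀ ℕ) (f : MvPolynomial σ B) :
    coeffSpan A f = coeffSpan A (eraseTerm d f) + Submodule.span A {f.coeff d} := by
  refine le_antisymm (coeffSpan_le_iff.2 fun e => ?_)
    (add_le (coeffSpan_le_iff.2 fun e => ?_) ?_)
  · obtain rfl | hed := eq_or_ne e d
    · exact Submodule.mem_sup_right (Submodule.mem_span_singleton_self _)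
    · rw [← coeff_eraseTerm_of_ne f hed]
      exact Submodule.mem_sup_left (coeff_mem_coeffSpan A _ e)
  · obtain rfl | hed := eq_or_ne e d
    · rw [coeff_eraseTerm_self]
      exact zero_mem _
    · rw [coeff_eraseTerm_of_ne f hed]
      exact coeff_mem_coeffSpan A f e
  · rw [Submodule.span_singleton_le_iff_mem]
    exact coeff_mem_coeffSpan A f d

theorem coeffSpan_eraseTerm_mul_le (d : σ →₀ ℕ) (f g : MvPolynomial σ B) :
    coeffSpan A (eraseTerm d f * g) ≤
      coeffSpan A (f * g) + Submodule.span A {f.coeff d} * coeffSpan A g := by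
  rw [coeffSpan_le_iff, eraseTerm, sub_mul]
  have hle : coeffSpan A (monomial d (f.coeff d) * g) ≤
      Submodule.span A {f.coeff d} * coeffSpan A g := by
    rw [coeffSpan_le_iff, coeffsIn_mul]
    exact Submodule.mul_mem_mul (monomial_mem_coeffsIn.2 (Submodule.mem_span_singleton_self _))
      (coeffSpan_le_iff.1 le_rfl)
  exact sub_mem (coeffSpan_le_iff.1 le_self_add) (coeffSpan_le_iff.1 (hle.trans le_add_self))

theorem span_coeff_degree_mul_le (m : MonomialOrder σ) (f g : MvPolynomial σ B) :
    Submodule.span A {f.coeff (m.degree f)} * Submodule.span A {g.coeff (m.degree g)} ≤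
      coeffSpan A (f * g) := by
  rw [Submodule.span_mul_span, Set.singleton_mul_singleton, Submodule.span_singleton_le_iff_mem]
  exact m.coeff_mul_of_degree_add (f := f) (g := g) ▸ coeff_mem_coeffSpan A (f * g) _

/-- The **Dedekind–Mertens lemma**, with an exponent which is not sharp. -/
theorem coeffSpan_pow_mul_le {N : ℕ} (f g : MvPolynomial σ B) (hg : g.support.card ≤ N) :
    coeffSpan A f ^ (N + 1) * coeffSpan A g ≤ coeffSpan A f ^ N * coeffSpan A (f * g) := by
  obtain ⟨_, _⟩ := exists_wellFoundedGT σ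
  let m : MonomialOrder σ := .lex
  induction N generalizing f g with
  | zero =>
    obtain rfl : g = 0 := by simpa using hg
    simp [coeffSpan_zero]
  | succ k ih =>
    obtain rfl | hg0 := eq_or_ne g 0
    · simp [coeffSpan_zero]
    induction hn : f.support.card using Nat.strong_induction_on generalizing f with
    | _ n ihf =>
      obtain rfl | hf0 := eq_or_ne f 0
      · simp [coeffSpan_zero]
      refine dedekindMertens_step k (coeffSpan_eq_add A (m.degree f) f)
        (coeffSpan_eq_add A (m.degree g) g) (span_coeff_degree_mul_le A m f g)
        (mul_comm g f ▸ coeffSpan_eraseTerm_mul_le A (m.degree g) g f)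
        (coeffSpan_eraseTerm_mul_le A (m.degree f) f g) ?_ ?_
      · rw [mul_comm (eraseTerm _ g)]
        exact ih f _ (Nat.lt_succ_iff.1
          ((card_support_eraseTerm_lt ((m.degree_mem_support_iff g).2 hg0)).trans_le hg))
      · exact ihf _ (hn ▸ card_support_eraseTerm_lt ((m.degree_mem_support_iff f).2 hf0)) _ rfl

end DedekindMertens

section Kronecker

variable {A B : Type*} [CommRing A] [CommRing B] [Algebra A B]

-- The submodule `(M + 1) ^ n` is a subalgebra.
theorem isIntegral_of_mem_of_pow_succ_le_pow {M : Submodule A B} (hM : M.FG) {n : ℕ}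
    (h : M ^ (n + 1) ≤ M ^ n) {x : B} (hx : x ∈ M) : IsIntegral A x := by
  set E := M + 1
  have hone : 1 ≤ E := le_add_self
  have hME : M ≤ E := le_self_add
  have hsucc : E ^ (n + 1) ≤ E ^ n :=
    calc E ^ (n + 1) ≤ M ^ (n + 1) + 1 * E ^ n := add_pow_succ_le M 1 n
      _ ≤ E ^ n + 1 * E ^ n := add_le_add (h.trans (by gcongr)) le_rfl
      _ = E ^ n := by rw [one_mul, add_idem]
  have hstab (k : ℕ) : E ^ (n + k) ≤ E ^ n := by
    induction k with
    | zero => exact le_rfl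
    | succ k ih =>
      calc E ^ (n + k + 1) = E ^ (n + k) * E := pow_succ _ _
        _ ≤ E ^ n * E := by gcongr
        _ = E ^ (n + 1) := (pow_succ _ _).symm
        _ ≤ E ^ n := hsucc
  let S : Subalgebra A B := (E ^ n).toSubalgebra (Submodule.one_le.1 (one_le_pow₀ hone))
    fun x y hx hy => hstab n (pow_add E n n ▸ Submodule.mul_mem_mul hx hy)
  have hxS : x ∈ S := hsucc (le_self_pow₀ hone n.succ_ne_zero (hME hx))
  have hSfg : (Subalgebra.toSubmodule S).FG := by
    rw [Submodule.toSubalgebra_toSubmodule]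
    have hone_fg : (1 : Submodule A B).FG := ⟨{1}, by simp [Submodule.one_eq_span]⟩
    exact (hM.sup hone_fg).pow n
  exact IsIntegral.of_mem_of_fg S hSfg x hxS

/-- **Kronecker's theorem**. -/
theorem isIntegral_coeff_mul_coeff {σ : Type*} {f g : MvPolynomial σ B}
    (h : ∀ d, (f * g).coeff d ∈ (⊥ : Subalgebra A B)) (d e : σ →₀ ℕ) :
    IsIntegral A (f.coeff d * g.coeff e) := by
  set F := coeffSpan A f
  set G := coeffSpan A g
  let N := g.support.card
  have hfg : coeffSpan A (f * g) ≤ 1 :=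
    coeffSpan_le_iff.2 fun d => (Algebra.toSubmodule_bot (R := A) (A := B)).le (h d)
  have hle : F ^ (N + 1) * G ≤ F ^ N :=
    calc F ^ (N + 1) * G ≤ F ^ N * coeffSpan A (f * g) := coeffSpan_pow_mul_le A f g le_rfl
      _ ≤ F ^ N * 1 := by gcongr
      _ = F ^ N := mul_one _
  refine isIntegral_of_mem_of_pow_succ_le_pow (n := N) ((coeffSpan_fg A f).mul (coeffSpan_fg A g))
    ?_ (Submodule.mul_mem_mul (coeff_mem_coeffSpan A f d) (coeff_mem_coeffSpan A g e))
  calc (F * G) ^ (N + 1) = F ^ (N + 1) * G * G ^ N := by ring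
    _ ≤ F ^ N * G ^ N := by gcongr
    _ = (F * G) ^ N := (mul_pow _ _ _).symm

end Kronecker

theorem eq_sum_mul_mul_of_sum_mul_eq_one {ι R : Type*} [CommRing R] [Fintype ι] {f g : ι → R}
    (hsum : ∑ i, f i * g i = 1) (p : R) : p = ∑ i, p * g i * f i :=
  calc p = p * ∑ i, f i * g i := by rw [hsum, mul_one]
    _ = ∑ i, p * g i * f i := by
      rw [Finset.mul_sum]
      exact Finset.sum_congr rfl fun i _ => by ring

section Pair

variable {σ ι A B C : Type*} [CommRing A] [CommRing B] [CommRing C] [Algebra A B] [Algebra A C]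

/-- Finite families `f` and `g` of polynomials over `B` which generate mutually inverse
`A[X]`-submodules of `B[X]`, normalized so that their constant coefficients come from `A`.
Membership in the image of `A` in an `A`-algebra is expressed by the bottom subalgebra. -/
structure IsNormalizedInversePair (A : Type*) [CommRing A] [Algebra A B] [Fintype ι]
    (f g : ι → MvPolynomial σ B) : Prop where
  sum_mul_eq_one : ∑ i, f i * g i = 1
  coeff_mul_mem_bot : ∀ i j d, (f i * g j).coeff d ∈ (⊥ : Subalgebra A B)
  coeff_zero_left_mem_bot : ∀ i, (f i).coeff 0 ∈ (⊥ : Subalgebra A B)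
  coeff_zero_right_mem_bot : ∀ i, (g i).coeff 0 ∈ (⊥ : Subalgebra A B)

theorem exists_map_eq_of_coeff_mem_range {R S : Type*} [CommRing R] [CommRing S] {φ : R →+* S}
    {p : MvPolynomial σ S} (h : ∀ d, p.coeff d ∈ φ.range) : ∃ q, map φ q = p := by
  refine mem_range_map_iff_coeffs_subset.2 fun c hc => ?_
  obtain ⟨d, -, rfl⟩ := mem_coeffs_iff.1 hc
  exact h d

theorem algHom_apply_mem_bot_iff {φ : B →ₐ[A] C} (hφ : Function.Injective φ) {b : B} :
    φ b ∈ (⊥ : Subalgebra A C) ↔ b ∈ (⊥ : Subalgebra A B) := by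
  rw [← Algebra.map_bot φ]
  exact Subalgebra.mem_map.trans (by simp [hφ.eq_iff])

namespace IsNormalizedInversePair

variable [Fintype ι] {f g : ι → MvPolynomial σ B}

theorem symm (h : IsNormalizedInversePair A f g) : IsNormalizedInversePair A g f where
  sum_mul_eq_one := by simpa only [mul_comm] using h.sum_mul_eq_one
  coeff_mul_mem_bot i j := mul_comm (g i) (f j) ▸ h.coeff_mul_mem_bot j i
  coeff_zero_left_mem_bot := h.coeff_zero_right_mem_bot
  coeff_zero_right_mem_bot := h.coeff_zero_left_mem_bot

theorem map {k K : Type*} [CommRing k] [CommRing K] [Algebra k K]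
    (h : IsNormalizedInversePair A f g) {ψ : B →+* K}
    (hψ : ∀ b ∈ (⊥ : Subalgebra A B), ψ b ∈ (⊥ : Subalgebra k K)) :
    IsNormalizedInversePair k (fun i => MvPolynomial.map ψ (f i))
      fun i => MvPolynomial.map ψ (g i) where
  sum_mul_eq_one := by simp_rw [← map_mul, ← map_sum, h.sum_mul_eq_one, map_one]
  coeff_mul_mem_bot i j d := by
    rw [← map_mul, coeff_map]
    exact hψ _ (h.coeff_mul_mem_bot i j d)
  coeff_zero_left_mem_bot i := by
    rw [coeff_map]
    exact hψ _ (h.coeff_zero_left_mem_bot i)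
  coeff_zero_right_mem_bot i := by
    rw [coeff_map]
    exact hψ _ (h.coeff_zero_right_mem_bot i)

theorem of_map {φ : B →ₐ[A] C} (hφ : Function.Injective φ)
    (h : IsNormalizedInversePair A (fun i => MvPolynomial.map (φ : B →+* C) (f i))
      fun i => MvPolynomial.map (φ : B →+* C) (g i)) : IsNormalizedInversePair A f g where
  sum_mul_eq_one := map_injective (φ : B →+* C) hφ (by
    simpa only [map_sum, map_mul, map_one] using h.sum_mul_eq_one)
  coeff_mul_mem_bot i j d := (algHom_apply_mem_bot_iff hφ).1 (by
    simpa only [← map_mul, coeff_map, RingHom.coe_coe] using h.coeff_mul_mem_bot i j d)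
  coeff_zero_left_mem_bot i := (algHom_apply_mem_bot_iff hφ).1 (by
    simpa only [coeff_map, RingHom.coe_coe] using h.coeff_zero_left_mem_bot i)
  coeff_zero_right_mem_bot i := (algHom_apply_mem_bot_iff hφ).1 (by
    simpa only [coeff_map, RingHom.coe_coe] using h.coeff_zero_right_mem_bot i)

theorem sum_coeff_zero_mul_coeff_zero (h : IsNormalizedInversePair A f g) :
    ∑ i, (f i).coeff 0 * (g i).coeff 0 = 1 := by
  simpa only [map_sum, map_mul, map_one, constantCoeff_eq] using
    congrArg constantCoeff h.sum_mul_eq_one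

theorem isIntegral_coeff (h : IsNormalizedInversePair A f g) (i : ι) (d : σ →₀ ℕ) :
    IsIntegral A ((f i).coeff d) := by
  rw [eq_sum_mul_mul_of_sum_mul_eq_one h.sum_coeff_zero_mul_coeff_zero ((f i).coeff d)]
  refine IsIntegral.sum _ fun j _ =>
    (isIntegral_coeff_mul_coeff (h.coeff_mul_mem_bot i j) d 0).mul ?_
  obtain ⟨a, ha⟩ := Algebra.mem_bot.1 (h.coeff_zero_left_mem_bot j)
  exact ha ▸ isIntegral_algebraMap

end IsNormalizedInversePair

end Pair

section CoeffAlgebra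

variable {σ ι : Type*} (A : Type*) {B : Type*} [CommRing A] [CommRing B] [Algebra A B]

/-- The `A`-subalgebra of `B` generated by the coefficients of a family of polynomials over `B`. -/
noncomputable def coeffAlgebra (F : ι → MvPolynomial σ B) : Subalgebra A B :=
  Algebra.adjoin A (⋃ i, ((F i).coeffs : Set B))

variable {A} {F : ι → MvPolynomial σ B}

theorem coeffAlgebra_le_iff {S : Subalgebra A B} :
    coeffAlgebra A F ≤ S ↔ ∀ i d, (F i).coeff d ∈ S := by
  rw [coeffAlgebra, Algebra.adjoin_le_iff, Set.iUnion_subset_iff]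
  refine forall_congr' fun i => ?_
  exact mem_coeffsIn_iff_coeffs_subset (M := Subalgebra.toSubmodule S) |>.symm.trans mem_coeffsIn

theorem coeff_mem_coeffAlgebra (i : ι) (d : σ →₀ ℕ) : (F i).coeff d ∈ coeffAlgebra A F :=
  coeffAlgebra_le_iff.1 le_rfl i d

theorem finite_coeffAlgebra [Finite ι] (h : ∀ i d, IsIntegral A ((F i).coeff d)) :
    Module.Finite A (coeffAlgebra A F) := by
  refine Algebra.finite_adjoin_of_finite_of_isIntegral
    (Set.finite_iUnion fun i => (F i).coeffs.finite_toSet) ?_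
  simp only [Set.mem_iUnion, Finset.mem_coe, mem_coeffs_iff]
  rintro _ ⟨i, d, -, rfl⟩
  exact h i d

theorem coeffAlgebra_eq_top_of_map_val_eq {F' : ι → MvPolynomial σ (coeffAlgebra A F)}
    (h : ∀ i, map ((coeffAlgebra A F).val : coeffAlgebra A F →+* B) (F' i) = F i) :
    coeffAlgebra A F' = ⊤ := by
  have hle : coeffAlgebra A F ≤ (coeffAlgebra A F').map (coeffAlgebra A F).val :=
    coeffAlgebra_le_iff.2 fun i d =>
      ⟨(F' i).coeff d, coeff_mem_coeffAlgebra i d, by simp [← h i, coeff_map]⟩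
  refine eq_top_iff.2 fun x _ => ?_
  obtain ⟨y, hy, hyx⟩ := hle x.2
  exact Subtype.ext hyx ▸ hy

end CoeffAlgebra

section Field

theorem exists_units_span_range_eq {ι R S : Type*} [CommRing R] [IsDomain R] [IsGCDMonoid R]
    [CommRing S] [Algebra R S] [FaithfulSMul R S] [Fintype ι] {f g : ι → S}
    (hsum : ∑ i, f i * g i = 1) (hmul : ∀ i j, f i * g j ∈ (1 : Submodule R S)) :
    ∃ u : Sˣ, Submodule.span R (Set.range f) = Submodule.span R {(u : S)} := by
  have hinv : Submodule.span R (Set.range f) * Submodule.span R (Set.range g) = 1 := by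
    refine le_antisymm ?_ ?_
    · rw [Submodule.span_mul_span, Submodule.span_le]
      rintro _ ⟨_, ⟨i, rfl⟩, _, ⟨j, rfl⟩, rfl⟩
      exact hmul i j
    · rw [Submodule.one_le, ← hsum]
      exact sum_mem fun i _ => Submodule.mul_mem_mul (Submodule.subset_span ⟨i, rfl⟩)
        (Submodule.subset_span ⟨i, rfl⟩)
  have hker : Units.mkOfMulEqOne _ _ hinv ∈ (Submodule.unitsToPic R S).ker :=
    Subsingleton.elim _ _
  rw [Submodule.ker_unitsToPic] at hker
  obtain ⟨u, hu⟩ := hker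
  exact ⟨u, congrArg Units.val hu.symm⟩

theorem IsNormalizedInversePair.coeff_mem_bot_of_field {σ ι k K : Type*} [Field k] [CommRing K]
    [IsReduced K] [Algebra k K] [Fintype ι] {f g : ι → MvPolynomial σ K}
    (h : IsNormalizedInversePair k f g) (i : ι) (d : σ →₀ ℕ) :
    (f i).coeff d ∈ (⊥ : Subalgebra k K) := by
  cases subsingleton_or_nontrivial K
  · exact Subsingleton.elim 0 ((f i).coeff d) ▸ zero_mem _
  let _ : Algebra (MvPolynomial σ k) (MvPolynomial σ K) := algebraMvPolynomial
  have hsmul (a : MvPolynomial σ k) (p : MvPolynomial σ K) :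
      a • p = MvPolynomial.map (algebraMap k K) a * p := Algebra.smul_def a p
  obtain ⟨u, hu⟩ := exists_units_span_range_eq (R := MvPolynomial σ k) h.sum_mul_eq_one fun i j =>
    Submodule.mem_one.2 (exists_map_eq_of_coeff_mem_range (h.coeff_mul_mem_bot i j))
  obtain ⟨r, -, hr⟩ := isUnit_iff_eq_C_of_isReduced.1 u.isUnit
  have hr_mem : r ∈ (⊥ : Subalgebra k K) := by
    obtain ⟨c, hc⟩ := (Submodule.mem_span_range_iff_exists_fun _).1
      (hu.ge (Submodule.mem_span_singleton_self (u : MvPolynomial σ K)))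
    have hr_eq : r = ∑ i, algebraMap k K ((c i).coeff 0) * (f i).coeff 0 := by
      simpa [hsmul, hr, ← constantCoeff_eq, constantCoeff_map] using
        congrArg constantCoeff hc.symm
    exact hr_eq ▸ sum_mem fun i _ =>
      mul_mem (Subalgebra.algebraMap_mem _ _) (h.coeff_zero_left_mem_bot i)
  obtain ⟨a, ha⟩ := Submodule.mem_span_singleton.1 (hu.le (Submodule.subset_span ⟨i, rfl⟩))
  rw [← ha, hsmul, hr, mul_comm, coeff_C_mul, coeff_map]
  exact mul_mem hr_mem (Subalgebra.algebraMap_mem _ _)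

end Field

section Map

variable {σ ι A B k K : Type*} [CommRing A] [CommRing B] [Algebra A B] [CommRing k] [CommRing K]
  [Algebra k K] {ψ : B →+* K}

theorem map_mem_coeffAlgebra {F : ι → MvPolynomial σ B}
    (hψ : ∀ b ∈ (⊥ : Subalgebra A B), ψ b ∈ (⊥ : Subalgebra k K)) {b : B}
    (hb : b ∈ coeffAlgebra A F) : ψ b ∈ coeffAlgebra k fun i => map ψ (F i) := by
  let S : Subalgebra A B :=
    { ((coeffAlgebra k fun i => map ψ (F i)).toSubring.comap ψ) with
      algebraMap_mem' := fun a =>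
        (bot_le : ⊥ ≤ coeffAlgebra k _) (hψ _ (Subalgebra.algebraMap_mem _ a)) }
  have hle : coeffAlgebra A F ≤ S := coeffAlgebra_le_iff.2 fun i d => by
    have hmem : (map ψ (F i)).coeff d ∈ coeffAlgebra k fun i => map ψ (F i) :=
      coeff_mem_coeffAlgebra (F := fun i => map ψ (F i)) i d
    rwa [coeff_map] at hmem
  exact hle hb

end Map

section Localization

variable {A B : Type*} [CommRing A] [CommRing B] [Algebra A B] (p : Ideal A) [p.IsPrime]

theorem exists_notMem_smul_mem_bot {b : B}
    (h : algebraMap B (Localization (Algebra.algebraMapSubmonoid B p.primeCompl)) b ∈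
      (⊥ : Subalgebra (Localization.AtPrime p) _)) :
    ∃ s ∉ p, s • b ∈ (⊥ : Subalgebra A B) := by
  let K := Localization (Algebra.algebraMapSubmonoid B p.primeCompl)
  obtain ⟨x, hx⟩ := Algebra.mem_bot.1 h
  obtain ⟨⟨a, s⟩, hs⟩ := IsLocalization.surj p.primeCompl x
  have hsb : algebraMap B K (s • b) = algebraMap B K (algebraMap A B a) := by
    have := congrArg (algebraMap (Localization.AtPrime p) K) hs
    rw [map_mul, hx, ← IsScalarTower.algebraMap_apply, ← IsScalarTower.algebraMap_apply,
      IsScalarTower.algebraMap_apply A B K, IsScalarTower.algebraMap_apply A B K] at this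
    rw [Submonoid.smul_def, Algebra.smul_def, map_mul, mul_comm]
    exact this
  obtain ⟨⟨_, t, ht, rfl⟩, hc⟩ := (IsLocalization.eq_iff_exists
    (Algebra.algebraMapSubmonoid B p.primeCompl) K).1 hsb
  refine ⟨t * s, p.primeCompl.mul_mem ht s.2, Algebra.mem_bot.2 ⟨t * a, ?_⟩⟩
  rw [mul_smul, Algebra.smul_def t, map_mul]
  exact hc.symm

theorem exists_notMem_forall_smul_mem_bot [Module.Finite A B]
    (h : ∀ b, algebraMap B (Localization (Algebra.algebraMapSubmonoid B p.primeCompl)) b ∈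
      (⊥ : Subalgebra (Localization.AtPrime p) _)) :
    ∃ s ∉ p, ∀ b : B, s • b ∈ (⊥ : Subalgebra A B) := by
  let M := B ⧸ Subalgebra.toSubmodule (⊥ : Subalgebra A B)
  have hsupp : (⟨p, ‹_›⟩ : PrimeSpectrum A) ∉ Module.support A M := by
    refine Module.notMem_support_iff'.2 fun m => ?_
    obtain ⟨b, rfl⟩ := Submodule.Quotient.mk_surjective _ m
    obtain ⟨s, hs, hsb⟩ := exists_notMem_smul_mem_bot p (h b)
    exact ⟨s, hs, (Submodule.Quotient.mk_eq_zero _).2 hsb⟩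
  rw [Module.mem_support_iff_of_finite] at hsupp
  obtain ⟨s, hs, hsp⟩ := SetLike.not_le_iff_exists.1 hsupp
  exact ⟨s, hsp, fun b => (Submodule.Quotient.mk_eq_zero _).1
    (Module.mem_annihilator.1 hs (Submodule.Quotient.mk b))⟩

theorem IsNormalizedInversePair.exists_notMem_forall_smul_mem_bot {σ ι : Type*} [Fintype ι]
    {f g : ι → MvPolynomial σ B} [IsReduced A] [IsReduced B] [Module.Finite A B]
    (h : IsNormalizedInversePair A f g) (htop : coeffAlgebra A (Sum.elim f g) = ⊤)
    (hp : p ∈ minimalPrimes A) : ∃ s ∉ p, ∀ b : B, s • b ∈ (⊥ : Subalgebra A B) := by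
  have : Ring.KrullDimLE 0 (Localization.AtPrime p) := .of_isLocalization p hp _
  let _ : Field (Localization.AtPrime p) := Ring.KrullDimLE.isField_of_isReduced.toField
  let K := Localization (Algebra.algebraMapSubmonoid B p.primeCompl)
  have hbot : ∀ b ∈ (⊥ : Subalgebra A B),
      algebraMap B K b ∈ (⊥ : Subalgebra (Localization.AtPrime p) K) := fun b hb => by
    obtain ⟨a, rfl⟩ := Algebra.mem_bot.1 hb
    rw [← IsScalarTower.algebraMap_apply, IsScalarTower.algebraMap_apply A (Localization.AtPrime p)]
    exact Subalgebra.algebraMap_mem _ _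
  have hK := h.map hbot
  refine RingExt.exists_notMem_forall_smul_mem_bot p fun b => ?_
  have hle : coeffAlgebra (Localization.AtPrime p)
      (fun i => MvPolynomial.map (algebraMap B K) (Sum.elim f g i)) ≤ ⊥ :=
    coeffAlgebra_le_iff.2 (Sum.forall.2 ⟨hK.coeff_mem_bot_of_field, hK.symm.coeff_mem_bot_of_field⟩)
  exact hle (map_mem_coeffAlgebra hbot (htop ▸ Algebra.mem_top))

end Localization

section Conductor

variable (A B : Type*) [CommRing A] [CommRing B] [Algebra A B]

/-- `A` is seminormal in the `A`-algebra `B`: every element of `B` whose square and cube come from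
`A` comes from `A`. -/
def IsSeminormalIn : Prop :=
  ∀ b : B, b ^ 2 ∈ (⊥ : Subalgebra A B) → b ^ 3 ∈ (⊥ : Subalgebra A B) → b ∈ (⊥ : Subalgebra A B)

/-- The conductor of `A` in the `A`-algebra `B`, as an ideal of `B`. -/
def conductorIdeal : Ideal B where
  carrier := {b | ∀ c, b * c ∈ (⊥ : Subalgebra A B)}
  add_mem' ha hb c := add_mul _ _ c ▸ add_mem (ha c) (hb c)
  zero_mem' c := (zero_mul c).symm ▸ zero_mem _
  smul_mem' r b hb c := by
    rw [smul_eq_mul, mul_comm r, mul_assoc]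
    exact hb _

variable {A B}

theorem mem_bot_of_mem_conductorIdeal {b : B} (hb : b ∈ conductorIdeal A B) :
    b ∈ (⊥ : Subalgebra A B) :=
  mul_one b ▸ hb 1

theorem IsSeminormalIn.isRadical_conductorIdeal (hA : IsSeminormalIn A B) :
    (conductorIdeal A B).IsRadical := by
  rw [Ideal.isRadical_iff_pow_one_lt 2 one_lt_two]
  intro b hb c
  refine hA _ ?_ ?_
  · rw [mul_pow]
    exact hb _
  · rw [show (b * c) ^ 3 = b ^ 2 * (b * c ^ 3) by ring]
    exact hb _

variable {σ ι : Type*} [Fintype ι] {f g : ι → MvPolynomial σ B}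

theorem IsNormalizedInversePair.bot_eq_top [Module.Finite A B] (h : IsNormalizedInversePair A f g)
    (hA : IsSeminormalIn A B) (htop : coeffAlgebra A (Sum.elim f g) = ⊤) :
    (⊥ : Subalgebra A B) = ⊤ := by
  set c := conductorIdeal A B
  suffices hc : c = ⊤ from
    eq_top_iff.2 fun b _ => mem_bot_of_mem_conductorIdeal (hc ▸ Submodule.mem_top : b ∈ c)
  by_contra hne
  let A' := A ⧸ c.comap (algebraMap A B)
  let B' := B ⧸ c
  let π : B →+* B' := Ideal.Quotient.mk c
  have hrad : c.IsRadical := hA.isRadical_conductorIdeal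
  have : IsReduced A' := (Ideal.isRadical_iff_quotient_reduced _).1 (hrad.comap _)
  have : IsReduced B' := (Ideal.isRadical_iff_quotient_reduced _).1 hrad
  have : Nontrivial A' := Ideal.Quotient.nontrivial_iff.2 (Ideal.comap_ne_top _ hne)
  have : Module.Finite A' B' := Module.Finite.of_restrictScalars_finite A A' B'
  obtain ⟨p, hp⟩ := Ideal.nonempty_minimalPrimes (bot_ne_top (α := Ideal A'))
  have : p.IsPrime := hp.1.1
  have hbot : ∀ b ∈ (⊥ : Subalgebra A B), π b ∈ (⊥ : Subalgebra A' B') := fun b hb => by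
    obtain ⟨a, rfl⟩ := Algebra.mem_bot.1 hb
    exact Algebra.mem_bot.2 ⟨Ideal.Quotient.mk _ a, rfl⟩
  have htop' : coeffAlgebra A' (Sum.elim (fun i => MvPolynomial.map π (f i))
      fun i => MvPolynomial.map π (g i)) = ⊤ := by
    refine eq_top_iff.2 fun x _ => ?_
    obtain ⟨b, rfl⟩ := Ideal.Quotient.mk_surjective x
    have hmem := map_mem_coeffAlgebra hbot (htop ▸ Algebra.mem_top : b ∈ coeffAlgebra A _)
    rwa [← Function.comp_def, Sum.comp_elim] at hmem
  obtain ⟨s, hs, hsB⟩ := (h.map hbot).exists_notMem_forall_smul_mem_bot p htop' hp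
  obtain ⟨a, rfl⟩ := Ideal.Quotient.mk_surjective s
  have ha : algebraMap A B a ∈ c := fun b => by
    obtain ⟨x, hx⟩ := Algebra.mem_bot.1 (hsB (π b))
    obtain ⟨a', rfl⟩ := Ideal.Quotient.mk_surjective x
    have hsub : algebraMap A B a * b - algebraMap A B a' ∈ c :=
      Ideal.Quotient.eq.1 ((Algebra.smul_def _ _).symm.trans hx.symm)
    simpa using add_mem (mem_bot_of_mem_conductorIdeal hsub) (Subalgebra.algebraMap_mem ⊥ a')
  exact hs (Ideal.Quotient.eq_zero_iff_mem.2 (Ideal.mem_comap.2 ha) ▸ zero_mem p)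

theorem IsNormalizedInversePair.coeff_mem_bot (h : IsNormalizedInversePair A f g)
    (hA : IsSeminormalIn A B) (i : ι) (d : σ →₀ ℕ) : (f i).coeff d ∈ (⊥ : Subalgebra A B) := by
  let C := coeffAlgebra A (Sum.elim f g)
  have : Module.Finite A C :=
    finite_coeffAlgebra (Sum.forall.2 ⟨h.isIntegral_coeff, h.symm.isIntegral_coeff⟩)
  have hC : Function.Injective C.val := Subtype.val_injective
  choose F hF using fun i => exists_map_eq_of_coeff_mem_range (φ := (C.val : C →+* B))
    (p := Sum.elim f g i) fun d => ⟨⟨_, coeff_mem_coeffAlgebra i d⟩, rfl⟩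
  have hpair : IsNormalizedInversePair A (F ∘ Sum.inl) (F ∘ Sum.inr) :=
    .of_map hC (by simpa only [Function.comp_apply, hF, Sum.elim_inl, Sum.elim_inr] using h)
  have hseminormal : IsSeminormalIn A C := fun b => by
    simpa only [← algHom_apply_mem_bot_iff hC, map_pow] using hA (C.val b)
  have hbot := hpair.bot_eq_top hseminormal
    ((Sum.elim_comp_inl_inr F).symm ▸ coeffAlgebra_eq_top_of_map_val_eq hF)
  have hmem : (F (.inl i)).coeff d ∈ (⊥ : Subalgebra A C) := hbot ▸ Algebra.mem_top
  have hval : (C.val : C →+* B) ((F (.inl i)).coeff d) = (f i).coeff d := by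
    rw [← coeff_map, hF, Sum.elim_inl]
  exact hval ▸ (algHom_apply_mem_bot_iff hC).2 hmem

end Conductor

section PolynomialSubring

theorem mem_bot_iff_mem {B : Type*} [CommRing B] {A : Subring B} {b : B} :
    b ∈ (⊥ : Subalgebra A B) ↔ b ∈ A :=
  Algebra.mem_bot.trans ⟨by rintro ⟨a, rfl⟩; exact a.2, fun h => ⟨⟨b, h⟩, rfl⟩⟩

theorem mem_one_iff_mem {B : Type*} [CommRing B] {A : Subring B} {b : B} :
    b ∈ (1 : Submodule A B) ↔ b ∈ A :=
  Submodule.mem_one.trans (Algebra.mem_bot.symm.trans mem_bot_iff_mem)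

theorem notMem_vars_of_notMem_vars_mul {σ ι B : Type*} [CommRing B] [IsReduced B] [Fintype ι]
    {f g : ι → MvPolynomial σ B} (hsum : ∑ i, f i * g i = 1) {s : σ}
    (hvars : ∀ i j, s ∉ (f i * g j).vars) (i : ι) : s ∉ (f i).vars := by
  intro hs
  obtain ⟨d, hd, hsd⟩ := (mem_vars_iff_mem_support s).1 hs
  refine mem_support_iff.1 hd (IsReduced.eq_zero _ (nilpotent_iff_mem_prime.2 fun P hP => ?_))
  by_contra hdP
  let π := map (σ := σ) (Ideal.Quotient.mk P)
  have hsπ : s ∈ (π (f i)).vars := by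
    refine (mem_vars_iff_mem_support s).2 ⟨d, mem_support_iff.2 ?_, hsd⟩
    rwa [coeff_map, Ne, Ideal.Quotient.eq_zero_iff_mem]
  have hi : π (f i) ≠ 0 := fun h => by simp [h] at hsπ
  obtain ⟨j, hj⟩ : ∃ j, π (g j) ≠ 0 := by
    by_contra! hall
    simpa [hall] using congrArg π hsum
  refine hvars i j (vars_map _ (Ideal.Quotient.mk P) ?_)
  rw [mem_vars_iff_degreeOf_ne_zero] at hsπ ⊢
  rw [map_mul, degreeOf_mul_eq hi hj]
  omega

variable {B : Type*} [CommRing B] (A : Subring B) (σ τ : Type*)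

/-- The polynomial ring over `A` in the variables `σ`, as a subring of the polynomial ring over `B`
in the variables `σ ⊕ τ`; `polySubring` is the case of finitely many variables. -/
noncomputable def polynomialSubring : Subring (MvPolynomial (σ ⊕ τ) B) :=
  ((rename (R := B) (Sum.inl : σ → σ ⊕ τ)).toRingHom.comp (map A.subtype)).range

theorem C_mem_polynomialSubring (a : B) (ha : a ∈ A) :
    (C a : MvPolynomial (σ ⊕ τ) B) ∈ polynomialSubring A σ τ :=
  ⟨C ⟨a, ha⟩, by simp⟩

variable {A σ τ}

theorem mem_polynomialSubring_iff {p : MvPolynomial (σ ⊕ τ) B} :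
    p ∈ polynomialSubring A σ τ ↔ (∀ d, p.coeff d ∈ A) ∧ ∀ j, Sum.inr j ∉ p.vars := by
  constructor
  · rintro ⟨q, rfl⟩
    change (∀ d, (rename Sum.inl (map A.subtype q)).coeff d ∈ A) ∧
      ∀ j, Sum.inr j ∉ (rename Sum.inl (map A.subtype q)).vars
    refine ⟨fun d => ?_, fun j hj => ?_⟩
    · rw [← map_rename, coeff_map]
      exact Subtype.prop _
    · obtain ⟨i, -, hi⟩ := mem_vars_rename _ _ hj
      exact Sum.inl_ne_inr hi
  · rintro ⟨hcoeff, hvars⟩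
    obtain ⟨q, rfl⟩ := exists_rename_eq_of_vars_subset_range p Sum.inl Sum.inl_injective <| by
      rintro (i | j) hi
      exacts [⟨i, rfl⟩, (hvars j hi).elim]
    obtain ⟨r, rfl⟩ := exists_map_eq_of_coeff_mem_range (φ := A.subtype) (p := q) fun d => by
      rw [Subring.range_subtype, ← coeff_rename_mapDomain _ Sum.inl_injective]
      exact hcoeff _
    exact ⟨r, rfl⟩

theorem constantCoeff_mem_of_mem_polynomialSubring (p : MvPolynomial (σ ⊕ τ) B)
    (hp : p ∈ polynomialSubring A σ τ) : constantCoeff p ∈ A :=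
  (mem_polynomialSubring_iff.1 hp).1 0

theorem mem_polynomialSubring_of_mul_mem {ι : Type*} [Fintype ι] (hA : IsSeminormalIn A B)
    (hB : IsEmpty τ ∨ IsReduced B) {f g : ι → MvPolynomial (σ ⊕ τ) B} (hsum : ∑ i, f i * g i = 1)
    (hmul : ∀ i j, f i * g j ∈ polynomialSubring A σ τ) (hf : ∀ i, constantCoeff (f i) ∈ A)
    (hg : ∀ i, constantCoeff (g i) ∈ A) (i : ι) : f i ∈ polynomialSubring A σ τ := by
  have hpair : IsNormalizedInversePair A f g :=
    { sum_mul_eq_one := hsum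
      coeff_mul_mem_bot := fun i j d =>
        mem_bot_iff_mem.2 ((mem_polynomialSubring_iff.1 (hmul i j)).1 d)
      coeff_zero_left_mem_bot := fun i => mem_bot_iff_mem.2 (hf i)
      coeff_zero_right_mem_bot := fun i => mem_bot_iff_mem.2 (hg i) }
  refine mem_polynomialSubring_iff.2
    ⟨fun d => mem_bot_iff_mem.1 (hpair.coeff_mem_bot hA i d), fun t => ?_⟩
  obtain hτ | hB := hB
  · exact isEmptyElim t
  · exact notMem_vars_of_notMem_vars_mul hsum
      (fun i j => (mem_polynomialSubring_iff.1 (hmul i j)).2 t) i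

end PolynomialSubring

section InvSubmodules

variable {B : Type*} [CommRing B] {A : Subring B}

theorem IsSubintegrallyClosed.isSeminormalIn (hA : IsSubintegrallyClosed A) :
    IsSeminormalIn A B := by
  simp only [IsSeminormalIn, mem_bot_iff_mem]
  intro b h2 h3
  have hsub : IsSubintegral A (Algebra.adjoin A {b}).toSubring :=
    ⟨{(Algebra.adjoin A {b}).toSubring}, by
      rintro _ rfl
      exact .single ⟨b, h2, h3, rfl⟩, by simp⟩
  exact hA.le ((le_sSup hsub : _ ≤ subintegralClosure A) (Algebra.subset_adjoin rfl))

theorem exists_fin_sum_mul_eq_of_mem_mul {R S : Type*} [CommSemiring R] [Semiring S] [Algebra R S]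
    {M N : Submodule R S} {x : S} (hx : x ∈ M * N) :
    ∃ (n : ℕ) (f g : Fin n → S), (∀ i, f i ∈ M) ∧ (∀ i, g i ∈ N) ∧ ∑ i, f i * g i = x := by
  rw [Submodule.mul_eq_span_mul_set, Submodule.mem_span_set'] at hx
  obtain ⟨n, c, y, rfl⟩ := hx
  choose f hf g hg hfg using fun i => (y i).2
  exact ⟨n, fun i => c i • f i, g, fun i => M.smul_mem _ (hf i), hg, by
    simp only [smul_mul_assoc, hfg]⟩

theorem extendSubmodule_leftInverse {B' : Type*} [CommRing B'] {A' : Subring B'} {φ : B →+* B'}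
    {ψ : B' →+* B} (hφ : ∀ a ∈ A, φ a ∈ A') (hψ : ∀ a ∈ A', ψ a ∈ A)
    (h : Function.LeftInverse ψ φ) :
    Function.LeftInverse (extendSubmodule ψ hψ) (extendSubmodule φ hφ) := by
  intro I
  refine le_antisymm (Submodule.span_le.2 ?_) fun b hb =>
    Submodule.subset_span ⟨φ b, Submodule.subset_span ⟨b, hb, rfl⟩, h b⟩
  rintro _ ⟨p, hp, rfl⟩
  change p ∈ Submodule.span A' (φ '' I) at hp
  change ψ p ∈ I
  induction hp using Submodule.span_induction with
  | mem x hx =>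
    obtain ⟨b, hb, rfl⟩ := hx
    rwa [h]
  | zero => exact map_zero ψ ▸ zero_mem I
  | add x y _ _ hx hy => exact map_add ψ x y ▸ add_mem hx hy
  | smul a x _ hx =>
    rw [Subring.smul_def, smul_eq_mul, map_mul]
    exact I.smul_mem ⟨ψ a, hψ a a.2⟩ hx

namespace InvSubmodules

theorem mul_mem_of_mem_inv (I : InvSubmodules A) {p q : B} (hp : p ∈ I.val) (hq : q ∈ I⁻¹.val) :
    p * q ∈ A :=
  mem_one_iff_mem.1 (I.mul_inv ▸ Submodule.mul_mem_mul hp hq)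

theorem exists_fin_sum_mul_eq_one (I : InvSubmodules A) : ∃ (n : ℕ) (f g : Fin n → B),
    (∀ i, f i ∈ I.val) ∧ (∀ i, g i ∈ I⁻¹.val) ∧ ∑ i, f i * g i = 1 :=
  exists_fin_sum_mul_eq_of_mem_mul (I.mul_inv.ge (Submodule.one_le.1 le_rfl))

theorem apply_mem_of_map_eq_one {B' : Type*} [CommRing B'] {A' : Subring B'} {φ : B →+* B'}
    {h : ∀ a ∈ A, φ a ∈ A'} {I : InvSubmodules A} (hI : map φ h I = 1) {p : B} (hp : p ∈ I.val) :
    φ p ∈ A' :=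
  mem_one_iff_mem.1 ((congrArg Units.val hI).le (Submodule.subset_span ⟨p, hp, rfl⟩))

theorem eq_one_of_le_one {I : InvSubmodules A} (h : I.val ≤ 1) (h' : I⁻¹.val ≤ 1) : I = 1 :=
  Units.ext <| le_antisymm h <| calc
    (1 : Submodule A B) = I.val * I⁻¹.val := I.mul_inv.symm
    _ ≤ I.val * 1 := mul_le_mul_right h' _
    _ = I.val := mul_one _

variable {σ τ : Type*}

theorem le_one_of_map_constantCoeff_eq_one (hA : IsSeminormalIn A B)
    (hB : IsEmpty τ ∨ IsReduced B) {I : InvSubmodules (polynomialSubring A σ τ)}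
    (hI : map constantCoeff constantCoeff_mem_of_mem_polynomialSubring I = 1) : I.val ≤ 1 := by
  have hI' : map constantCoeff constantCoeff_mem_of_mem_polynomialSubring I⁻¹ = 1 := by
    rw [map_inv, hI, inv_one]
  obtain ⟨n, f, g, hf, hg, hsum⟩ := I.exists_fin_sum_mul_eq_one
  have hfA : ∀ i, f i ∈ polynomialSubring A σ τ :=
    mem_polynomialSubring_of_mul_mem hA hB hsum (fun i j => I.mul_mem_of_mem_inv (hf i) (hg j))
      (fun i => apply_mem_of_map_eq_one hI (hf i)) fun i => apply_mem_of_map_eq_one hI' (hg i)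
  intro p hp
  rw [eq_sum_mul_mul_of_sum_mul_eq_one hsum p]
  exact mem_one_iff_mem.2 (sum_mem fun i _ => mul_mem (I.mul_mem_of_mem_inv hp (hg i)) (hfA i))

theorem map_constantCoeff_injective (hA : IsSeminormalIn A B) (hB : IsEmpty τ ∨ IsReduced B) :
    Function.Injective <|
      map (A := polynomialSubring A σ τ) constantCoeff constantCoeff_mem_of_mem_polynomialSubring :=
  (injective_iff_map_eq_one _).2 fun I hI =>
    eq_one_of_le_one (le_one_of_map_constantCoeff_eq_one hA hB hI)
      (le_one_of_map_constantCoeff_eq_one hA hB (by rw [map_inv, hI, inv_one]))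

end InvSubmodules

end InvSubmodules

end RingExt

theorem corollary3p5_general {B : Type*} [CommRing B] {A : Subring B}
    (hA : RingExt.IsSubintegrallyClosed A) (σ τ : Type*) (hB : IsEmpty τ ∨ IsReduced B) :
    Function.Bijective (RingExt.InvSubmodules.map
      (MvPolynomial.C : B →+* MvPolynomial (σ ⊕ τ) B) (RingExt.C_mem_polynomialSubring A σ τ)) := by
  have hleft : Function.LeftInverse (RingExt.InvSubmodules.map MvPolynomial.constantCoeff
        RingExt.constantCoeff_mem_of_mem_polynomialSubring)
      (RingExt.InvSubmodules.map MvPolynomial.C (RingExt.C_mem_polynomialSubring A σ τ)) :=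
    fun I => Units.ext (RingExt.extendSubmodule_leftInverse (RingExt.C_mem_polynomialSubring A σ τ)
      RingExt.constantCoeff_mem_of_mem_polynomialSubring (MvPolynomial.constantCoeff_C _) I.val)
  exact ⟨hleft.injective, (hleft.rightInverse_of_injective
    (RingExt.InvSubmodules.map_constantCoeff_injective hA.isSeminormalIn hB)).surjective⟩

/-- The isomorphism is the canonical one: it is induced by the inclusion of `B` in
`B[X₁, …, Xₘ, Y₁, …, Yₙ]`. (`A` is reduced since it is a subring of the reduced ring `B`.) -/
theorem corollary3p5 {B : Type*} [CommRing B] [IsReduced B] (A : Subring B)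
    (hA : RingExt.IsSubintegrallyClosed A) (m n : ℕ) :
    ∃ e : RingExt.InvSubmodules A ≃* RingExt.InvSubmodules (RingExt.polySubring A m n),
      ∀ I : RingExt.InvSubmodules A,
        e I = RingExt.InvSubmodules.map (MvPolynomial.C : B →+* MvPolynomial (Fin m ⊕ Fin n) B)
          (RingExt.C_mem_polySubring A m n) I :=
  ⟨MulEquiv.ofBijective _ (corollary3p5_general hA (Fin m) (Fin n) (.inr ‹_›)), fun _ => rfl⟩
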